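/- Let $\mathcal H=\ell^2(\mathbb Z^3)$ be the Hilbert space of square-summable complex-valued functions on $\mathbb Z^3$, and let $\Omega=\Delta_1+\Delta_2+\Delta_3$ be the discrete Laplacian on $\mathcal H$, where $(\Delta_j f)(n)=f(n+e_j)-2f(n)+f(n-e_j)$. For a bounded self-adjoint operator $T$ on a Hilbert space and a set $S$ of vectors, the orbit $\mathcal O_T(S)$ is the closed linear span of $\{f(T)v : f\in C_0^\infty(\mathbb R),\ v\in S\}$. The multiplicity of $T$ is the least number (possibly infinite) of vectors forming a set $S$ for which $\mathcal O_T(S)$ is the whole space. Let $N\ge 1$ be an integer, let $\mathcal Q=\{n\in\mathbb Z^3 : 0\le n_j<N,\ j=1,2,3\}$, and let its surface be the set of $n\in\mathcal Q$ with some coordinate equal to $0$ or $N-1$. Let $H_1\subset\mathcal H$ be the space of functions vanishing off $\mathcal Q$, let $H_2=\mathcal H\ominus H_1$, and let $\Gamma:H_2\to H_1$ be the coupling operator $\Gamma=P_{H_1}\Omega|_{H_2}$, where $P_{H_1}$ is the orthogonal projection onto $H_1$. The minimal conservative extension of $H_1$ in $(\mathcal H,\Omega)$ is $\mathcal O_\Omega(H_1)$.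 Put $H_{2c}=\mathcal O_\Omega(H_1)\ominus H_1$ and $H_{2d}=H_2\ominus H_{2c}$, the decoupled part of $H_2$. Then: 1. $\dim H_1=N^3$. 2. The range of $\Gamma$ is exactly the space of functions on the surface of $\mathcal Q$ (extended by $0$). If $N\ge 2$, its dimension is $6N^2-12N+8$. 3. $\mathcal O_\Omega(H_1)$ is invariant under $\Omega$, and the restriction of $\Omega$ to it has finite multiplicity, at most $12N^2-24N+16$. 4. $\Omega$ has infinite multiplicity on $\mathcal H$. 5. $H_{2d}$ is invariant under $\Omega$, and the restriction of $\Omega$ to $H_{2d}$ has infinite multiplicity. -/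

import Mathlib

open scoped ContDiff

noncomputable section

namespace LatticeExample

section General

variable {E : Type*} [NormedAddCommGroup E] [InnerProductSpace ℂ E] [CompleteSpace E]

/-- The orbit `O_T(S)` of a set `S` under a bounded self-adjoint operator `T`: the closed linear
span of the vectors `f(T) v`, with `v ∈ S` and `f` a smooth compactly supported function on the
line, where `f(T)` is the functional calculus of `T`. (The span is complex, so that real-valued
and complex-valued `f` give the same orbit.) -/
def orbit (T : E →L[ℂ] E) (S : Set E) : Submodule ℂ E :=
  (Submodule.span ℂ {w : E | ∃ f : ℝ → ℝ, ContDiff ℝ ∞ f ∧ HasCompactSupport f ∧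
    ∃ v ∈ S, w = cfc f T v}).topologicalClosure

instance orbit_completeSpace (T : E →L[ℂ] E) (S : Set E) : CompleteSpace (orbit T S) :=
  (Submodule.isClosed_topologicalClosure _).completeSpace_coe

/-- The spectral multiplicity of a bounded self-adjoint operator `T`: the least number of vectors
that generate the whole space through `T`, and `⊤` if no finite set of vectors does. -/
def spectralMultiplicity (T : E →L[ℂ] E) : ℕ∞ :=
  ⨅ (S : Set E) (_ : orbit T S = ⊤), S.encard

/-- The coupling operator `Γ : H₂ → H₁`, with `H₂ = H₁ᗮ`: the off-diagonal block of `T` in the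
decomposition of the space as `H₁ ⊕ H₂`. -/
def coupling (T : E →L[ℂ] E) (H₁ : Submodule ℂ E) [CompleteSpace H₁] : H₁ᗮ →L[ℂ] H₁ :=
  H₁.orthogonalProjectionOnto ∘L T ∘L H₁ᗮ.subtypeL

/-- The minimal conservative extension of `H₁` within the given system: the orbit of `H₁`. -/
abbrev minimalExtension (T : E →L[ℂ] E) (H₁ : Submodule ℂ E) : Submodule ℂ E :=
  orbit T (H₁ : Set E)

/-- The coupled part `H₂c = O_T(H₁) ⊖ H₁` of the hidden variables. -/
def hiddenCoupled (T : E →L[ℂ] E) (H₁ : Submodule ℂ E) : Submodule ℂ E :=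
  minimalExtension T H₁ ⊓ H₁ᗮ

/-- The decoupled part `H₂d = H₂ ⊖ H₂c` of the hidden variables, with `H₂ = H₁ᗮ`. -/
def hiddenDecoupled (T : E →L[ℂ] E) (H₁ : Submodule ℂ E) : Submodule ℂ E :=
  H₁ᗮ ⊓ (hiddenCoupled T H₁)ᗮ

instance hiddenDecoupled_completeSpace (T : E →L[ℂ] E) (H₁ : Submodule ℂ E) :
    CompleteSpace (hiddenDecoupled T H₁) :=
  IsComplete.completeSpace_coe
    (H₁.isClosed_orthogonal.inter (hiddenCoupled T H₁).isClosed_orthogonal).isComplete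

end General

/-- The lattice `ℤ³`. -/
abbrev Lattice : Type := Fin 3 → ℤ

/-- The Hilbert space `ℓ²(ℤ³)` of square-summable complex-valued functions on the lattice. -/
abbrev LatticeSpace : Type := lp (fun _ : Lattice => ℂ) 2

theorem memℓp_shift (v : Lattice) (f : LatticeSpace) :
    Memℓp (fun n : Lattice => f (n + v)) 2 := by
  have h := (memℓp_gen_iff (p := 2) (by norm_num)).1 (lp.memℓp f)
  exact (memℓp_gen_iff (p := 2) (by norm_num)).2 ((Equiv.addRight v).summable_iff.2 h)

/-- The translation `(shift v f)(n) = f(n + v)`. -/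
def shift (v : Lattice) : LatticeSpace →L[ℂ] LatticeSpace :=
  LinearMap.mkContinuous
    { toFun := fun f => ⟨fun n => f (n + v), memℓp_shift v f⟩
      map_add' := fun _ _ => rfl
      map_smul' := fun _ _ => rfl } 1 (by
    intro f
    rw [one_mul]
    refine le_of_eq ?_
    have h2 : 0 < (2 : ENNReal).toReal := by norm_num
    rw [lp.norm_eq_tsum_rpow h2, lp.norm_eq_tsum_rpow h2]
    congr 1
    exact (Equiv.addRight v).tsum_eq (fun n => ‖f n‖ ^ (2 : ENNReal).toReal))

@[simp]
theorem shift_apply (v : Lattice) (f : LatticeSpace) (n : Lattice) : shift v f n = f (n + v) :=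
  rfl

/-- The `j`-th elementary vector of the lattice. -/
def stdVec (j : Fin 3) : Lattice := Pi.single j 1

/-- The discrete Laplacian `Ω = Δ₁ + Δ₂ + Δ₃` on `ℓ²(ℤ³)`. -/
def laplacian : LatticeSpace →L[ℂ] LatticeSpace :=
  ∑ j : Fin 3, (shift (stdVec j) - (2 : ℂ) • ContinuousLinearMap.id ℂ LatticeSpace
    + shift (-stdVec j))

theorem laplacian_apply (f : LatticeSpace) (n : Lattice) :
    laplacian f n = ∑ j : Fin 3, (f (n + stdVec j) - 2 * f n + f (n - stdVec j)) := by
  have h2 : ∀ g : LatticeSpace, ((2 : ℂ) • g : LatticeSpace) n = 2 * g n := fun _ => rfl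
  simp only [laplacian, Fin.sum_univ_three, add_apply, sub_apply, smul_apply,
    ContinuousLinearMap.id_apply, lp.coeFn_add, lp.coeFn_sub, Pi.add_apply, Pi.sub_apply,
    shift_apply, h2]
  simp only [sub_eq_add_neg]

theorem inner_shift_left (v : Lattice) (f g : LatticeSpace) :
    inner ℂ (shift v f) g = inner ℂ f (shift (-v) g) := by
  rw [lp.inner_eq_tsum, lp.inner_eq_tsum, ← (Equiv.addRight v).tsum_eq
    (fun n => inner ℂ (f n) (shift (-v) g n))]
  simp

/-- The discrete Laplacian is self-adjoint, so that its functional calculus is meaningful. -/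
theorem isSelfAdjoint_laplacian : IsSelfAdjoint laplacian := by
  rw [ContinuousLinearMap.isSelfAdjoint_iff_isSymmetric]
  intro f g
  simp only [laplacian, Fin.sum_univ_three, ContinuousLinearMap.coe_coe,
    add_apply, sub_apply, smul_apply,
    ContinuousLinearMap.id_apply, inner_add_left, inner_add_right, inner_sub_left,
    inner_sub_right, inner_shift_left, inner_smul_left, inner_smul_right, neg_neg, map_ofNat]
  ring

/-- The square-summable functions on the lattice that vanish off `A`, that is, the
square-summable functions on `A`. -/
def functionsOn (A : Set Lattice) : Submodule ℂ LatticeSpace where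
  carrier := {f | ∀ n, n ∉ A → f n = 0}
  zero_mem' := fun _ _ => rfl
  add_mem' := fun hf hg n hn => by simp [hf n hn, hg n hn]
  smul_mem' := fun c f hf n hn => by simp [hf n hn]

instance functionsOn_completeSpace (A : Set Lattice) : CompleteSpace (functionsOn A) := by
  refine IsComplete.completeSpace_coe (IsClosed.isComplete ?_)
  have h : ((functionsOn A : Submodule ℂ LatticeSpace) : Set LatticeSpace)
      = ⋂ n, ⋂ (_ : n ∉ A), {f : LatticeSpace | f n = 0} := by
    ext f
    simp only [Set.mem_iInter, Set.mem_ofPred_eq]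
    rfl
  rw [h]
  refine isClosed_iInter fun n => isClosed_iInter fun _ => isClosed_eq ?_ continuous_const
  exact ((continuous_apply n).comp (lp.uniformContinuous_coe (p := 2)).continuous)

/-- The cube `Q` of the points `n` with `0 ≤ n_j < N` for `j = 1, 2, 3`. -/
def cube (N : ℕ) : Set Lattice := {n | ∀ j, 0 ≤ n j ∧ n j < N}

/-- The observable subspace `H₁`: the functions on the cube. -/
abbrev cubeSpace (N : ℕ) : Submodule ℂ LatticeSpace := functionsOn (cube N)

/-- The surface of the cube: its points with some coordinate equal to `0` or `N - 1`. -/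
def cubeSurface (N : ℕ) : Set Lattice := {n ∈ cube N | ∃ j, n j = 0 ∨ n j = (N : ℤ) - 1}

end LatticeExample

end

open LatticeExample

/-! Infinite multiplicity of Ω. The Fourier transform turns Ω into multiplication by the symbol
2(cos θ₁ + cos θ₂ + cos θ₃) - 6, whose level sets are infinite. If k vectors generated the space,
then on a level set every function would be a limit of combinations of k fixed functions with
coefficients constant on that level set. Its values at k + 1 points of the level set would then lie
in a space of dimension at most k, yet the powers 1, z, ..., z^k of one character give an invertible
Vandermonde matrix there (`orbit_laplacian_ne_top`).

Finite multiplicity of the minimal extension. Ω couples only nearest neighbours, so Ωδ_m leaves the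
cube only when m is on the surface. The surface point masses, with the outer parts of their images,
suffice to recover all point masses in the cube layer by layer (`single_mem_orbit`). The same
locality gives the range of Γ (`map_range_coupling`).

The decoupled part is the orthogonal complement of the minimal extension. Were it finitely
generated, the union of two finite generating sets would generate the whole space
(`spectralMultiplicity_ne_top`). -/

noncomputable section

namespace LatticeExample

/-! ### Orbits, invariant subspaces and multiplicity for a general self-adjoint operator. -/

section General

variable {E : Type*} [NormedAddCommGroup E] [InnerProductSpace ℂ E] [CompleteSpace E]

/-- The operators that, together with their adjoints, leave a subspace invariant. -/
def invariantOperators (W : Submodule ℂ E) : StarSubalgebra ℝ (E →L[ℂ] E) where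
  carrier := {A | (∀ x ∈ W, A x ∈ W) ∧ ∀ x ∈ W, star A x ∈ W}
  mul_mem' := fun {A B} hA hB =>
    ⟨fun x hx => hA.1 _ (hB.1 x hx), fun x hx => by
      rw [star_mul]; exact hB.2 _ (hA.2 x hx)⟩
  add_mem' := fun {A B} hA hB =>
    ⟨fun x hx => W.add_mem (hA.1 x hx) (hB.1 x hx), fun x hx => by
      rw [star_add]; exact W.add_mem (hA.2 x hx) (hB.2 x hx)⟩
  algebraMap_mem' := fun r => by
    have h : ∀ x ∈ W, algebraMap ℝ (E →L[ℂ] E) r x ∈ W := fun x hx => by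
      rw [Algebra.algebraMap_eq_smul_one]
      exact W.smul_of_tower_mem r hx
    refine ⟨h, ?_⟩
    rw [← algebraMap_star_comm]
    simpa using h
  star_mem' := fun {A} hA => ⟨hA.2, by rw [star_star]; exact hA.1⟩

theorem isClosed_invariantOperators {W : Submodule ℂ E} (hW : IsClosed (W : Set E)) :
    IsClosed (invariantOperators W : Set (E →L[ℂ] E)) := by
  have h : (invariantOperators W : Set (E →L[ℂ] E))
      = (⋂ x ∈ W, {A : E →L[ℂ] E | A x ∈ (W : Set E)})
        ∩ ⋂ x ∈ W, {A : E →L[ℂ] E | star A x ∈ (W : Set E)} := by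
    ext A
    simp only [Set.mem_inter_iff, Set.mem_iInter, Set.mem_ofPred_eq]
    rfl
  rw [h]
  refine IsClosed.inter ?_ ?_ <;> refine isClosed_biInter fun x _ => hW.preimage ?_
  · fun_prop
  · exact (ContinuousLinearMap.apply ℂ E x).continuous.comp continuous_star

/-- `cfc f T` lies in the closed real star subalgebra generated by `T`, which is contained in
`invariantOperators W`. Continuity of `f` is not needed, since `cfc` is 0 by default when `f` is not
continuous on the spectrum. -/
theorem cfc_apply_mem {T : E →L[ℂ] E} (hT : IsSelfAdjoint T) {W : Submodule ℂ E}
    (hW : IsClosed (W : Set E)) (hTW : ∀ x ∈ W, T x ∈ W) (f : ℝ → ℝ) {x : E} (hx : x ∈ W) :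
    cfc f T x ∈ W := by
  have h1 : T ∈ invariantOperators W := ⟨hTW, by rw [hT.star_eq]; exact hTW⟩
  have h2 := StarAlgebra.elemental.le_of_mem (isClosed_invariantOperators hW) h1
    (cfc_mem_elemental f T)
  exact h2.1 x hx

theorem orbit_le {T : E →L[ℂ] E} (hT : IsSelfAdjoint T) {S : Set E} {W : Submodule ℂ E}
    (hW : IsClosed (W : Set E)) (hTW : ∀ x ∈ W, T x ∈ W) (hS : S ⊆ W) : orbit T S ≤ W := by
  refine Submodule.topologicalClosure_minimal _ (Submodule.span_le.2 ?_) hW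
  rintro w ⟨f, -, -, v, hv, rfl⟩
  exact cfc_apply_mem hT hW hTW f (hS hv)

theorem cfc_apply_mem_orbit (T : E →L[ℂ] E) {S : Set E} {v : E} (hv : v ∈ S) {f : ℝ → ℝ}
    (hf : ContDiff ℝ ∞ f) (hc : HasCompactSupport f) : cfc f T v ∈ orbit T S :=
  Submodule.le_topologicalClosure _ (Submodule.subset_span ⟨f, hf, hc, v, hv, rfl⟩)

theorem subset_orbit {T : E →L[ℂ] E} (hT : IsSelfAdjoint T) (S : Set E) :
    S ⊆ orbit T S := by
  intro v hv
  obtain ⟨R, hR, hs⟩ := (ContinuousFunctionalCalculus.isCompact_spectrum (R := ℝ)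
    (p := IsSelfAdjoint) T).isBounded.subset_closedBall_lt 0 0
  -- A bump function equal to 1 on the spectrum makes the identity one of the operators `f(T)`.
  let b : ContDiffBump (0 : ℝ) := ⟨R, R + 1, hR, by linarith⟩
  have h1 : cfc (b : ℝ → ℝ) T = 1 := by
    rw [cfc_congr (g := fun _ => (1 : ℝ)) fun x hx => b.one_of_mem_closedBall (hs hx),
      cfc_const_one ℝ T]
  have h := cfc_apply_mem_orbit T hv (b.contDiff (n := ⊤)) b.hasCompactSupport
  rwa [h1] at h

theorem isClosed_orbit (T : E →L[ℂ] E) (S : Set E) : IsClosed (orbit T S : Set E) :=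
  Submodule.isClosed_topologicalClosure _

theorem apply_mem_orbit {T : E →L[ℂ] E} (hT : IsSelfAdjoint T) {S : Set E} {x : E}
    (hx : x ∈ orbit T S) : T x ∈ orbit T S := by
  suffices h : orbit T S ≤ (orbit T S).comap T.toLinearMap from h hx
  refine Submodule.topologicalClosure_minimal _ (Submodule.span_le.2 ?_)
    ((isClosed_orbit T S).preimage T.continuous)
  rintro w ⟨f, hf, hc, v, hv, rfl⟩
  -- Test functions are stable under multiplication by `x`, so `T` permutes generators of the orbit
  -- among themselves up to changing `f`.
  have h1 : cfc (fun x => x * f x) T = T * cfc f T := by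
    rw [cfc_mul (fun x => x) f T (by fun_prop) hf.continuous.continuousOn, cfc_id' ℝ T]
  have h2 := cfc_apply_mem_orbit T hv (contDiff_id.mul hf) (hc.mul_left (f := id))
  change T (cfc f T v) ∈ orbit T S
  rw [← mul_apply_eq_comp, ← h1]
  exact h2

theorem orbit_mono (T : E →L[ℂ] E) {S S' : Set E} (h : S ⊆ S') : orbit T S ≤ orbit T S' := by
  refine Submodule.topologicalClosure_mono (Submodule.span_mono ?_)
  rintro w ⟨f, hf, hc, v, hv, rfl⟩
  exact ⟨f, hf, hc, v, h hv, rfl⟩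

theorem isSelfAdjoint_restrict {T : E →L[ℂ] E} (hT : IsSelfAdjoint T) {W : Submodule ℂ E}
    [CompleteSpace W] (h : ∀ x ∈ W, T x ∈ W) : IsSelfAdjoint (T.restrict h) := by
  rw [ContinuousLinearMap.isSelfAdjoint_iff_isSymmetric] at hT ⊢
  exact fun x y => hT x y

/-- Orbits within an invariant subspace are contained in the orbits in the whole space. -/
theorem orbit_restrict_le_comap {T : E →L[ℂ] E} (hT : IsSelfAdjoint T) {W : Submodule ℂ E}
    [CompleteSpace W] (h : ∀ x ∈ W, T x ∈ W) (S : Set W) :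
    orbit (T.restrict h) S ≤ (orbit T ((↑) '' S)).comap W.subtype := by
  refine orbit_le (isSelfAdjoint_restrict hT h)
    ((isClosed_orbit T _).preimage continuous_subtype_val)
    (fun x hx => apply_mem_orbit hT hx) fun x hx => ?_
  exact subset_orbit hT _ ⟨x, hx, rfl⟩

/-- Orbits in the whole space of vectors of an invariant subspace are contained in the orbits
within that subspace. -/
theorem orbit_le_map_orbit_restrict {T : E →L[ℂ] E} (hT : IsSelfAdjoint T) {W : Submodule ℂ E}
    [CompleteSpace W] (h : ∀ x ∈ W, T x ∈ W) (S : Set W) :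
    orbit T ((↑) '' S) ≤ (orbit (T.restrict h) S).map W.subtype := by
  have hr := isSelfAdjoint_restrict hT h
  refine orbit_le hT ?_ ?_ ?_
  · have hW : IsClosed (W : Set E) := (completeSpace_coe_iff_isComplete.1 ‹_›).isClosed
    have hc : IsClosed (orbit (T.restrict h) S : Set W) := isClosed_orbit _ _
    rw [Submodule.map_coe]
    exact hW.isClosedEmbedding_subtypeVal.isClosedMap _ hc
  · rintro _ ⟨x, hx, rfl⟩
    exact ⟨T.restrict h x, apply_mem_orbit hr hx, rfl⟩
  · rintro _ ⟨x, hx, rfl⟩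
    exact ⟨x, subset_orbit hr S hx, rfl⟩

theorem spectralMultiplicity_le {T : E →L[ℂ] E} {S : Set E} (h : orbit T S = ⊤) :
    spectralMultiplicity T ≤ S.encard :=
  iInf₂_le S h

theorem exists_finite_orbit_eq_top {T : E →L[ℂ] E} (h : spectralMultiplicity T ≠ ⊤) :
    ∃ S : Set E, S.Finite ∧ orbit T S = ⊤ := by
  by_contra! hc
  refine h (iInf₂_eq_top.2 fun S hS => Set.encard_eq_top ?_)
  exact fun hf => hc S hf hS

/-- A finite set that generates an invariant subspace bounds the multiplicity of the restriction. -/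
theorem spectralMultiplicity_restrict_le {T : E →L[ℂ] E} (hT : IsSelfAdjoint T)
    {W : Submodule ℂ E} [CompleteSpace W] (h : ∀ x ∈ W, T x ∈ W) {S : Set E}
    (hS : S ⊆ W) (hW : W ≤ orbit T S) :
    spectralMultiplicity (T.restrict h) ≤ S.encard := by
  have hi : ((↑) '' ((↑) ⁻¹' S : Set W) : Set E) = S := by
    exact (Subtype.image_preimage_coe (W : Set E) S).trans (Set.inter_eq_right.2 hS)
  rw [← hi, Subtype.val_injective.encard_image]
  refine spectralMultiplicity_le (eq_top_iff.2 fun x _ => ?_)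
  have hx := orbit_le_map_orbit_restrict hT h ((↑) ⁻¹' S : Set W) (by rw [hi]; exact hW x.2)
  obtain ⟨y, hy, hyx⟩ := hx
  rwa [← Subtype.ext hyx]

theorem le_minimalExtension {T : E →L[ℂ] E} (hT : IsSelfAdjoint T) (H₁ : Submodule ℂ E) :
    H₁ ≤ minimalExtension T H₁ :=
  subset_orbit hT _

/-- The decoupled part is the orthogonal complement of the minimal conservative extension. -/
theorem hiddenDecoupled_eq {T : E →L[ℂ] E} (hT : IsSelfAdjoint T) (H₁ : Submodule ℂ E)
    [CompleteSpace H₁] : hiddenDecoupled T H₁ = (minimalExtension T H₁)ᗮ := by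
  have hle := le_minimalExtension hT H₁
  refine le_antisymm (fun x hx => ?_)
    (le_inf (Submodule.orthogonal_le hle) (Submodule.orthogonal_le inf_le_left))
  rw [Submodule.mem_orthogonal]
  intro y hy
  -- Since `H₁` lies in the minimal extension, so does `b = y - a`; hence `b` is in the coupled
  -- part.
  obtain ⟨a, ha, b, hb, rfl⟩ := H₁.exists_add_mem_mem_orthogonal y
  have hb' : b ∈ hiddenCoupled T H₁ :=
    ⟨by simpa using Submodule.sub_mem _ hy (hle ha), hb⟩
  rw [inner_add_left, (Submodule.mem_orthogonal _ _).1 hx.1 a ha,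
    (Submodule.mem_orthogonal _ _).1 hx.2 b hb', add_zero]

theorem apply_mem_hiddenDecoupled {T : E →L[ℂ] E} (hT : IsSelfAdjoint T) (H₁ : Submodule ℂ E)
    [CompleteSpace H₁] {x : E} (hx : x ∈ hiddenDecoupled T H₁) : T x ∈ hiddenDecoupled T H₁ := by
  rw [hiddenDecoupled_eq hT, Submodule.mem_orthogonal] at hx ⊢
  intro y hy
  have hs := (ContinuousLinearMap.isSelfAdjoint_iff_isSymmetric.1 hT) y x
  exact hs.symm.trans (hx _ (apply_mem_orbit hT hy))

/-- If both the minimal conservative extension and the decoupled part are finitely generated,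
so is the whole space. -/
theorem spectralMultiplicity_ne_top {T : E →L[ℂ] E} (hT : IsSelfAdjoint T) {H₁ : Submodule ℂ E}
    [CompleteSpace H₁] (h : ∀ x ∈ minimalExtension T H₁, T x ∈ minimalExtension T H₁)
    (h' : ∀ x ∈ hiddenDecoupled T H₁, T x ∈ hiddenDecoupled T H₁)
    (hm : spectralMultiplicity (T.restrict h) ≠ ⊤)
    (hm' : spectralMultiplicity (T.restrict h') ≠ ⊤) : spectralMultiplicity T ≠ ⊤ := by
  obtain ⟨S, hS, hSt⟩ := exists_finite_orbit_eq_top hm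
  obtain ⟨S', hS', hSt'⟩ := exists_finite_orbit_eq_top hm'
  let R : Set E := (↑) '' S ∪ (↑) '' S'
  have hR : R.Finite := (hS.image _).union (hS'.image _)
  have h1 : minimalExtension T H₁ ≤ orbit T R := fun x hx => orbit_mono T Set.subset_union_left
    (orbit_restrict_le_comap hT h S
      (hSt ▸ Submodule.mem_top : (⟨x, hx⟩ : minimalExtension T H₁) ∈ _))
  have h2 : hiddenDecoupled T H₁ ≤ orbit T R := fun x hx => orbit_mono T Set.subset_union_right
    (orbit_restrict_le_comap hT h' S'
      (hSt' ▸ Submodule.mem_top : (⟨x, hx⟩ : hiddenDecoupled T H₁) ∈ _))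
  have h3 : orbit T R = ⊤ := by
    rw [hiddenDecoupled_eq hT] at h2
    rw [eq_top_iff, ← Submodule.sup_orthogonal_of_hasOrthogonalProjection
      (K := minimalExtension T H₁)]
    exact sup_le h1 h2
  exact ((spectralMultiplicity_le h3).trans_lt hR.encard_lt_top).ne

end General

/-! ### The Laplacian as a multiplication operator, and its infinite multiplicity. -/

section Fourier

open MeasureTheory Filter Topology UnitAddTorus

/-- The normalised Haar measure of the three-dimensional torus. -/
abbrev torusMeasure : Measure (UnitAddTorus (Fin 3)) :=
  Measure.pi fun _ => AddCircle.haarAddCircle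

/-- The Fourier transform from the lattice to the torus. -/
def latticeFourier : LatticeSpace ≃ₗᵢ[ℂ] Lp ℂ 2 torusMeasure :=
  (mFourierBasis (d := Fin 3)).repr.symm

theorem latticeFourier_single (n : Lattice) :
    latticeFourier (lp.single 2 n 1) =ᵐ[torusMeasure] mFourier n := by
  have h : latticeFourier (lp.single 2 n 1) = mFourierLp 2 n := by
    have h1 := (mFourierBasis (d := Fin 3)).repr_symm_single n
    rwa [coe_mFourierBasis] at h1
  rw [h]
  exact coeFn_mFourierLp 2 n

/-- Both sides have the same Fourier coefficients: multiplying by the character `-v` moves the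
coefficient at `n + v` to `n`. -/
theorem latticeFourier_shift (v : Lattice) (f : LatticeSpace) :
    latticeFourier (shift v f) =ᵐ[torusMeasure] fun x => mFourier (-v) x * latticeFourier f x := by
  have hm : MemLp (fun x => mFourier (-v) x * latticeFourier f x) 2 torusMeasure := by
    refine (Lp.memLp (latticeFourier f)).of_le
      ((mFourier (-v)).continuous.aestronglyMeasurable.mul (Lp.aestronglyMeasurable _))
      (ae_of_all _ fun x => ?_)
    rw [norm_mul]
    refine mul_le_of_le_one_left (norm_nonneg _) ?_
    exact ((mFourier (-v)).norm_coe_le_norm x).trans mFourier_norm.le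
  have h : latticeFourier (shift v f) = hm.toLp := by
    rw [← latticeFourier.symm.injective.eq_iff, LinearIsometryEquiv.symm_apply_apply]
    ext n
    have h1 : f (n + v) = mFourierCoeff (latticeFourier f) (n + v) := by
      rw [← mFourierBasis_repr]
      exact congrArg (fun g : LatticeSpace => g (n + v)) (latticeFourier.symm_apply_apply f).symm
    have h2 : latticeFourier.symm hm.toLp n = mFourierCoeff hm.toLp n := mFourierBasis_repr _ n
    rw [shift_apply, h1, h2]
    refine integral_congr_ae ?_
    filter_upwards [hm.coeFn_toLp] with x hx
    rw [hx, neg_add, mFourier_add, smul_eq_mul, smul_eq_mul, mul_assoc]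
  rw [h]
  exact hm.coeFn_toLp

/-- The symbol of the discrete Laplacian. -/
def laplacianSymbol (x : UnitAddTorus (Fin 3)) : ℂ :=
  ∑ j : Fin 3, (mFourier (-stdVec j) x - 2 + mFourier (stdVec j) x)

theorem latticeFourier_laplacian (f : LatticeSpace) :
    latticeFourier (laplacian f) =ᵐ[torusMeasure]
      fun x => laplacianSymbol x * latticeFourier f x := by
  have h1 : laplacian f = ∑ j : Fin 3, (shift (stdVec j) f - (2 : ℂ) • f
      + shift (-stdVec j) f) := by
    simp [laplacian, Fin.sum_univ_three]
  rw [h1, map_sum]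
  have h2 : ∀ j : Fin 3, latticeFourier (shift (stdVec j) f - (2 : ℂ) • f + shift (-stdVec j) f)
      =ᵐ[torusMeasure] fun x => (mFourier (-stdVec j) x - 2 + mFourier (stdVec j) x)
        * latticeFourier f x := fun j => by
    rw [map_add, map_sub, map_smul]
    filter_upwards [latticeFourier_shift (stdVec j) f, latticeFourier_shift (-stdVec j) f,
      Lp.coeFn_add (latticeFourier (shift (stdVec j) f) - (2 : ℂ) • latticeFourier f)
        (latticeFourier (shift (-stdVec j) f)),
      Lp.coeFn_sub (latticeFourier (shift (stdVec j) f)) ((2 : ℂ) • latticeFourier f),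
      Lp.coeFn_smul (2 : ℂ) (latticeFourier f)] with x a1 a2 a3 a4 a5
    rw [a3, Pi.add_apply, a4, Pi.sub_apply, a5, Pi.smul_apply, a1, a2, neg_neg, smul_eq_mul]
    ring
  rw [Fin.sum_univ_three]
  filter_upwards [h2 0, h2 1, h2 2,
    Lp.coeFn_add (latticeFourier (shift (stdVec 0) f - (2 : ℂ) • f + shift (-stdVec 0) f)
      + latticeFourier (shift (stdVec 1) f - (2 : ℂ) • f + shift (-stdVec 1) f))
      (latticeFourier (shift (stdVec 2) f - (2 : ℂ) • f + shift (-stdVec 2) f)),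
    Lp.coeFn_add (latticeFourier (shift (stdVec 0) f - (2 : ℂ) • f + shift (-stdVec 0) f))
      (latticeFourier (shift (stdVec 1) f - (2 : ℂ) • f + shift (-stdVec 1) f))]
    with x a0 a1 a2 a3 a4
  rw [a3, Pi.add_apply, a4, Pi.add_apply, a0, a1, a2, laplacianSymbol, Fin.sum_univ_three]
  ring

/-- The functions whose Fourier transform is a combination of those of the members of `s`, with
coefficients that depend on the symbol of the Laplacian only. -/
def symbolSpan (s : Finset LatticeSpace) : Submodule ℂ LatticeSpace where
  carrier := {w | ∃ c : LatticeSpace → ℂ → ℂ, latticeFourier w =ᵐ[torusMeasure]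
    fun x => ∑ v ∈ s, c v (laplacianSymbol x) * latticeFourier v x}
  zero_mem' := ⟨0, by
    rw [map_zero]
    filter_upwards [Lp.coeFn_zero ℂ 2 torusMeasure]
    simp⟩
  add_mem' := by
    rintro f g ⟨c, hc⟩ ⟨d, hd⟩
    refine ⟨c + d, ?_⟩
    rw [map_add]
    filter_upwards [hc, hd, Lp.coeFn_add (latticeFourier f) (latticeFourier g)] with x h1 h2 h3
    rw [h3, Pi.add_apply, h1, h2, ← Finset.sum_add_distrib]
    exact Finset.sum_congr rfl fun v _ => (add_mul _ _ _).symm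
  smul_mem' := by
    rintro a f ⟨c, hc⟩
    refine ⟨a • c, ?_⟩
    rw [map_smul]
    filter_upwards [hc, Lp.coeFn_smul a (latticeFourier f)] with x h1 h2
    rw [h2, Pi.smul_apply, h1, Finset.smul_sum]
    exact Finset.sum_congr rfl fun v _ => (mul_assoc _ _ _).symm

theorem subset_symbolSpan (s : Finset LatticeSpace) : (s : Set LatticeSpace) ⊆ symbolSpan s := by
  classical
  intro v hv
  refine ⟨fun u _ => if u = v then 1 else 0, ae_of_all _ fun x => ?_⟩
  simp [Finset.mem_coe.1 hv]

theorem laplacian_mem_symbolSpan {s : Finset LatticeSpace} {w : LatticeSpace}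
    (hw : w ∈ symbolSpan s) : laplacian w ∈ symbolSpan s := by
  obtain ⟨c, hc⟩ := hw
  refine ⟨fun v z => z * c v z, ?_⟩
  filter_upwards [hc, latticeFourier_laplacian w] with x h1 h2
  rw [h2, h1, Finset.mul_sum]
  exact Finset.sum_congr rfl fun v _ => (mul_assoc _ _ _).symm

/-- Applying Ω only multiplies the coefficients by the symbol. As the coefficients are arbitrary
functions, nothing about their measurability has to be tracked. -/
theorem orbit_le_closure_symbolSpan (s : Finset LatticeSpace) :
    orbit laplacian (s : Set LatticeSpace) ≤ (symbolSpan s).topologicalClosure := by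
  refine orbit_le isSelfAdjoint_laplacian (Submodule.isClosed_topologicalClosure _) ?_
    ((subset_symbolSpan s).trans (Submodule.le_topologicalClosure _))
  intro x hx
  refine map_mem_closure laplacian.continuous hx fun y hy => laplacian_mem_symbolSpan hy

/-- Successive extraction of subsequences, one for each index; it turns L² limits into simultaneous
pointwise limits. -/
theorem exists_seq_forall_tendsto_ae {α ι : Type*} [MeasurableSpace α] {μ : Measure α}
    (s : Finset ι) {f : ι → ℕ → α → ℂ} {g : ι → α → ℂ}
    (h : ∀ j ∈ s, TendstoInMeasure μ (f j) atTop (g j)) :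
    ∃ ns : ℕ → ℕ, StrictMono ns ∧
      ∀ j ∈ s, ∀ᵐ x ∂μ, Tendsto (fun i => f j (ns i) x) atTop (𝓝 (g j x)) := by
  classical
  induction s using Finset.induction_on with
  | empty => exact ⟨id, strictMono_id, by simp⟩
  | insert a s ha ih =>
    obtain ⟨ns, hns, hs⟩ := ih fun j hj => h j (Finset.mem_insert_of_mem hj)
    have h1 : TendstoInMeasure μ (fun i => f a (ns i)) atTop (g a) := fun ε hε =>
      (h a (Finset.mem_insert_self a s) ε hε).comp hns.tendsto_atTop
    obtain ⟨ms, hms, hm⟩ := h1.exists_seq_tendsto_ae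
    refine ⟨ns ∘ ms, hns.comp hms, fun j hj => ?_⟩
    rcases Finset.mem_insert.1 hj with rfl | hj
    · exact hm
    · filter_upwards [hs j hj] with x hx
      exact hx.comp hms.tendsto_atTop

/-- The displacements `(t, -t, 0)`, along which the sum of the coordinates is constant. -/
def levelShift (t : ℝ) : Fin 3 → ℝ := ![t, -t, 0]

/-- The point of the torus with the cosines `y + (t, -t, 0)`. -/
def levelPoint (t : ℝ) (y : Fin 3 → ℝ) : UnitAddTorus (Fin 3) :=
  fun i => ((Real.arccos (y i + levelShift t i) / (2 * Real.pi) : ℝ) : UnitAddCircle)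

/-- The box in which the level-preserving displacements are used. -/
def levelBox : Set (Fin 3 → ℝ) := Set.univ.pi fun _ => Set.Ioo (-(1 / 2)) (1 / 2)

theorem add_levelShift_mem {t : ℝ} (h0 : 0 ≤ t) (h1 : t ≤ 1 / 2) {y : Fin 3 → ℝ}
    (hy : y ∈ levelBox) (i : Fin 3) : -1 < y i + levelShift t i ∧ y i + levelShift t i < 1 := by
  have h2 := hy i (Set.mem_univ i)
  have h3 := h2.1
  have h4 := h2.2
  fin_cases i <;> simp [levelShift] at h3 h4 ⊢ <;> constructor <;> linarith

theorem mFourier_stdVec_levelPoint {t : ℝ} (h0 : 0 ≤ t) (h1 : t ≤ 1 / 2) {y : Fin 3 → ℝ}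
    (hy : y ∈ levelBox) (i : Fin 3) :
    (mFourier (stdVec i) (levelPoint t y)).re = y i + levelShift t i := by
  have h2 := add_levelShift_mem h0 h1 hy i
  have h3 : (2 * Real.pi * Complex.I * (1 : ℤ)
      * (Real.arccos (y i + levelShift t i) / (2 * Real.pi) : ℝ) / (1 : ℝ) : ℂ)
      = (Real.arccos (y i + levelShift t i) : ℝ) * Complex.I := by
    have := Real.pi_ne_zero
    push_cast
    field_simp
  rw [stdVec, mFourier_single, levelPoint, fourier_coe_apply, h3,
    Complex.exp_ofReal_mul_I_re, Real.cos_arccos h2.1.le h2.2.le]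

theorem laplacianSymbol_eq (x : UnitAddTorus (Fin 3)) :
    laplacianSymbol x = ∑ j : Fin 3, ((2 * (mFourier (stdVec j) x).re - 2 : ℝ) : ℂ) := by
  refine Finset.sum_congr rfl fun j _ => ?_
  rw [mFourier_neg]
  have h := Complex.add_conj (mFourier (stdVec j) x)
  push_cast at h ⊢
  linear_combination h

/-- The displacements cancel in the sum of cosines, so for fixed `y` all these points lie on one
level set of the symbol. -/
theorem laplacianSymbol_levelPoint {t : ℝ} (h0 : 0 ≤ t) (h1 : t ≤ 1 / 2) {y : Fin 3 → ℝ}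
    (hy : y ∈ levelBox) :
    laplacianSymbol (levelPoint t y) = ((2 * (y 0 + y 1 + y 2) - 6 : ℝ) : ℂ) := by
  rw [laplacianSymbol_eq, Fin.sum_univ_three]
  simp only [mFourier_stdVec_levelPoint h0 h1 hy]
  simp [levelShift]
  ring

theorem measurePreserving_coe_torus :
    MeasurePreserving (fun (x : Fin 3 → ℝ) i => (x i : UnitAddCircle))
      (volume.restrict (Set.univ.pi fun _ => Set.Ioc 0 1)) torusMeasure := by
  have h : ∀ _ : Fin 3, MeasurePreserving ((↑) : ℝ → UnitAddCircle)
      (volume.restrict (Set.Ioc 0 1)) AddCircle.haarAddCircle := fun _ => by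
    have h1 := UnitAddCircle.measurePreserving_mk 0
    rw [zero_add] at h1
    convert h1 using 1
    simp [AddCircle.volume_eq_smul_haarAddCircle]
  have h2 := measurePreserving_pi _ _ h
  rwa [← Measure.restrict_pi_pi] at h2

/-- Almost every point of the box is mapped outside of a given null set. -/
theorem ae_levelPoint {p : UnitAddTorus (Fin 3) → Prop} (hp : ∀ᵐ x ∂torusMeasure, p x) {t : ℝ}
    (h0 : 0 ≤ t) (h1 : t ≤ 1 / 2) :
    ∀ᵐ y ∂(volume : Measure (Fin 3 → ℝ)), y ∈ levelBox → p (levelPoint t y) := by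
  have h2 := measurePreserving_coe_torus.quasiMeasurePreserving.ae hp
  rw [ae_restrict_iff' (MeasurableSet.univ_pi fun _ => measurableSet_Ioc)] at h2
  let A : Set (Fin 3 → ℝ) := {x | ¬ (x ∈ (Set.univ.pi fun _ => Set.Ioc 0 1) →
    p fun i => (x i : UnitAddCircle))}
  -- `c` undoes `levelPoint t`, so the bad `y` lie in the image under `c` of a null set. This image
  -- is null because `c` is differentiable.
  let c : (Fin 3 → ℝ) → Fin 3 → ℝ := fun x i => Real.cos (2 * Real.pi * x i) - levelShift t i
  have hA : volume (c '' A) = 0 := by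
    refine addHaar_image_eq_zero_of_differentiableOn_of_addHaar_eq_zero volume ?_ h2
    refine Differentiable.differentiableOn (differentiable_pi.2 fun i => ?_)
    fun_prop
  refine ae_iff.2 (measure_mono_null (fun y hy => ?_) hA)
  simp only [Set.mem_ofPred_eq, Classical.not_imp] at hy
  have hpi := Real.pi_pos
  refine ⟨fun i => Real.arccos (y i + levelShift t i) / (2 * Real.pi), ?_, ?_⟩
  · refine Classical.not_imp.2 ⟨fun i _ => ?_, hy.2⟩
    have h3 := add_levelShift_mem h0 h1 hy.1 i
    refine ⟨div_pos (Real.arccos_pos.2 h3.2) (by positivity), ?_⟩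
    rw [div_le_one (by positivity)]
    linarith [Real.arccos_le_pi (y i + levelShift t i)]
  · funext i
    have h3 := add_levelShift_mem h0 h1 hy.1 i
    simp only [c]
    rw [mul_div_cancel₀ _ (by positivity), Real.cos_arccos h3.1.le h3.2.le]
    ring

theorem det_mul_eq_zero_of_card_lt {m n : Type*} [Fintype m] [Fintype n] [DecidableEq n]
    (h : Fintype.card m < Fintype.card n) (A : Matrix n m ℂ) (B : Matrix m n ℂ) :
    (A * B).det = 0 := by
  by_contra hd
  have h1 := Matrix.rank_of_isUnit (A * B)
    ((Matrix.isUnit_iff_isUnit_det _).2 (isUnit_iff_ne_zero.2 hd))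
  have h2 := (Matrix.rank_mul_le_left A B).trans A.rank_le_card_width
  omega

theorem mFourier_nsmul (j : ℕ) (v : Lattice) (x : UnitAddTorus (Fin 3)) :
    mFourier (j • v) x = mFourier v x ^ j := by
  induction j with
  | zero => rw [zero_smul, mFourier_zero, pow_zero]; rfl
  | succ j ih => rw [add_smul, one_smul, mFourier_add, ih, pow_succ]

/-- Singular matrices of approximants, sampled at `k + 1` points of one level set, would converge to
an invertible Vandermonde matrix. -/
theorem orbit_laplacian_ne_top (s : Finset LatticeSpace) :
    orbit laplacian (s : Set LatticeSpace) ≠ ⊤ := by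
  intro htop
  have hd : ∀ g : LatticeSpace, ∃ w : ℕ → LatticeSpace,
      (∀ n, w n ∈ symbolSpan s) ∧ Tendsto w atTop (𝓝 g) := fun g =>
    mem_closure_iff_seq_limit.1 (orbit_le_closure_symbolSpan s (htop ▸ Submodule.mem_top : g ∈ _))
  let k := s.card
  let g : Fin (k + 1) → LatticeSpace := fun j => lp.single 2 ((j : ℕ) • stdVec 0) 1
  choose w hw hlim using fun j => hd (g j)
  choose c hc using hw
  obtain ⟨ns, -, hns⟩ := exists_seq_forall_tendsto_ae (μ := torusMeasure) Finset.univ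
    (f := fun j n => latticeFourier (w j n)) (g := fun j => latticeFourier (g j)) fun j _ =>
      tendstoInMeasure_of_tendsto_Lp ((latticeFourier.continuous.tendsto _).comp (hlim j))
  -- `k + 1` distinct displacements within the range `[0, 1/2]` allowed by the box.
  let t : Fin (k + 1) → ℝ := fun l => (l : ℝ) / (2 * (k + 1))
  have ht0 : ∀ l, 0 ≤ t l := fun l => by positivity
  have ht1 : ∀ l, t l ≤ 1 / 2 := fun l => by
    have : (l : ℝ) ≤ k + 1 := by exact_mod_cast l.2.le
    rw [div_le_div_iff₀ (by positivity) (by positivity)]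
    linarith
  have hae : ∀ᵐ x ∂torusMeasure, ∀ j, (∀ n, latticeFourier (w j n) x
      = ∑ v ∈ s, c j n v (laplacianSymbol x) * latticeFourier v x) ∧
      latticeFourier (g j) x = mFourier ((j : ℕ) • stdVec 0) x ∧
      Tendsto (fun i => latticeFourier (w j (ns i)) x) atTop (𝓝 (latticeFourier (g j) x)) := by
    refine ae_all_iff.2 fun j => ?_
    filter_upwards [ae_all_iff.2 (hc j), latticeFourier_single ((j : ℕ) • stdVec 0),
      hns j (Finset.mem_univ j)] with x h1 h2 h3
    exact ⟨h1, h2, h3⟩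
  -- The box has positive volume, so one `y` in it avoids the exceptional null sets of all `k + 1`
  -- displacements at once.
  have hbox : volume levelBox ≠ 0 := by
    rw [levelBox, volume_pi_pi]
    norm_num
  obtain ⟨y, hyb, hy⟩ : ∃ y ∈ levelBox, ∀ l, y ∈ levelBox → _ := by
    have h1 := ae_all_iff.2 fun l => ae_levelPoint hae (ht0 l) (ht1 l)
    by_contra! hcon
    refine hbox (measure_mono_null (fun y hy => ?_) h1)
    obtain ⟨l, hl, hl'⟩ := hcon y hy
    exact fun h2 => hl' (h2 l hl)
  replace hy := fun l => hy l hyb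
  let x : Fin (k + 1) → UnitAddTorus (Fin 3) := fun l => levelPoint (t l) y
  let M : ℕ → Matrix (Fin (k + 1)) (Fin (k + 1)) ℂ := fun i =>
    Matrix.of fun l j => latticeFourier (w j (ns i)) (x l)
  let z : Fin (k + 1) → ℂ := fun l => mFourier (stdVec 0) (x l)
  have hM : Tendsto M atTop (𝓝 (Matrix.vandermonde z)) := by
    refine tendsto_pi_nhds.2 fun l => tendsto_pi_nhds.2 fun j => ?_
    have h1 := (hy l j).2.2
    rw [(hy l j).2.1, mFourier_nsmul] at h1
    exact h1
  have hM0 : ∀ i, (M i).det = 0 := fun i => by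
    -- The coefficients do not depend on `l`, as the symbol takes the same value at every `x l`;
    -- hence the factorisation through dimension `k`.
    have h1 : M i = (Matrix.of fun (l : Fin (k + 1)) (v : s) => latticeFourier (v : LatticeSpace)
        (x l)) * Matrix.of fun (v : s) (j : Fin (k + 1)) =>
          c j (ns i) v ((2 * (y 0 + y 1 + y 2) - 6 : ℝ) : ℂ) := by
      ext l j
      rw [Matrix.mul_apply]
      simp only [M, Matrix.of_apply]
      rw [(hy l j).1, laplacianSymbol_levelPoint (ht0 l) (ht1 l) hyb, ← Finset.sum_coe_sort]
      exact Finset.sum_congr rfl fun v _ => mul_comm _ _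
    rw [h1]
    exact det_mul_eq_zero_of_card_lt (by simp [k]) _ _
  have hdet : Tendsto (fun i => (M i).det) atTop (𝓝 (Matrix.vandermonde z).det) :=
    ((continuous_id.matrix_det).tendsto _).comp hM
  simp only [hM0] at hdet
  have h0 := tendsto_nhds_unique hdet tendsto_const_nhds
  refine Matrix.det_vandermonde_ne_zero_iff.2 (fun l l' hl => ?_) h0
  -- The nodes are distinct already in their real parts, the first cosines `y 0 + t l`.
  have h1 := congrArg Complex.re hl
  simp only [z, x] at h1
  rw [mFourier_stdVec_levelPoint (ht0 l) (ht1 l) hyb,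
    mFourier_stdVec_levelPoint (ht0 l') (ht1 l') hyb] at h1
  simp only [levelShift, Matrix.cons_val_zero, add_right_inj, t] at h1
  have h2 : (2 * ((k : ℝ) + 1)) ≠ 0 := by positivity
  rw [div_left_inj' h2] at h1
  exact Fin.ext (by exact_mod_cast h1)

theorem spectralMultiplicity_laplacian : spectralMultiplicity laplacian = ⊤ := by
  by_contra h
  obtain ⟨S, hS, ht⟩ := exists_finite_orbit_eq_top h
  exact orbit_laplacian_ne_top hS.toFinset (by rwa [hS.coe_toFinset])

end Fourier

/-! ### Functions on the cube, the range of the coupling, and generators of the minimal extension.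
-/

section Cube

theorem single_mem_functionsOn {A : Set Lattice} {n : Lattice} (hn : n ∈ A) :
    (lp.single 2 n 1 : LatticeSpace) ∈ functionsOn A := fun m hm => by
  refine lp.single_apply_ne 2 n _ ?_
  rintro rfl
  exact hm hn

theorem eq_sum_single {A : Finset Lattice} {f : LatticeSpace}
    (hf : f ∈ functionsOn (A : Set Lattice)) :
    f = ∑ n ∈ A, f n • (lp.single 2 n 1 : LatticeSpace) := by
  ext m
  rw [lp.coeFn_sum, Finset.sum_apply]
  simp only [lp.coeFn_smul, Pi.smul_apply, lp.single_apply, Pi.single_apply, smul_eq_mul,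
    mul_ite, mul_one, mul_zero, Finset.sum_ite_eq]
  split_ifs with h
  · rfl
  · exact hf m h

theorem functionsOn_le {A : Set Lattice} (hA : A.Finite) {W : Submodule ℂ LatticeSpace}
    (h : ∀ n ∈ A, (lp.single 2 n 1 : LatticeSpace) ∈ W) : functionsOn A ≤ W := by
  lift A to Finset Lattice using hA
  intro f hf
  rw [eq_sum_single hf]
  exact W.sum_mem fun n hn => W.smul_mem _ (h n hn)

theorem finrank_functionsOn {A : Set Lattice} (hA : A.Finite) :
    Module.finrank ℂ (functionsOn A) = A.ncard := by
  lift A to Finset Lattice using hA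
  let L : functionsOn (A : Set Lattice) →ₗ[ℂ] A → ℂ :=
    { toFun := fun f n => (f : LatticeSpace) n
      map_add' := fun _ _ => rfl
      map_smul' := fun _ _ => rfl }
  have hL : Function.Bijective L := by
    refine ⟨(injective_iff_map_eq_zero L).2 fun f hf => ?_, fun g => ?_⟩
    · ext n
      by_cases hn : n ∈ A
      · exact congrFun hf ⟨n, hn⟩
      · exact f.2 n hn
    · refine ⟨∑ n : A, g n • ⟨lp.single 2 (n : Lattice) 1, single_mem_functionsOn n.2⟩, ?_⟩
      rw [map_sum]
      ext m
      rw [Finset.sum_apply, Finset.sum_eq_single m]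
      · rw [map_smul, Pi.smul_apply]
        have h : (lp.single 2 (m : Lattice) (1 : ℂ) : LatticeSpace) m = 1 :=
          lp.single_apply_self 2 _ _
        exact (congrArg (g m • ·) h).trans (mul_one _)
      · intro n _ hnm
        have h : (lp.single 2 (n : Lattice) (1 : ℂ) : LatticeSpace) m = 0 :=
          lp.single_apply_ne 2 _ _ fun h => hnm (Subtype.ext h.symm)
        rw [map_smul, Pi.smul_apply]
        exact (congrArg (g n • ·) h).trans (smul_zero _)
      · simp
  rw [(LinearEquiv.ofBijective L hL).finrank_eq, Module.finrank_fintype_fun_eq_card,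
    Fintype.card_coe, Set.ncard_coe_finset]

theorem inner_single_one (n : Lattice) (f : LatticeSpace) :
    inner ℂ (lp.single 2 n 1 : LatticeSpace) f = f n := by
  rw [lp.inner_single_left]
  simp

theorem mem_orthogonal_functionsOn {A : Set Lattice} {f : LatticeSpace} :
    f ∈ (functionsOn A)ᗮ ↔ ∀ n ∈ A, f n = 0 := by
  rw [Submodule.mem_orthogonal]
  refine ⟨fun h n hn => ?_, fun h g hg => ?_⟩
  · rw [← inner_single_one]
    exact h _ (single_mem_functionsOn hn)
  · rw [lp.inner_eq_tsum]
    refine (tsum_congr fun n => ?_).trans tsum_zero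
    by_cases hn : n ∈ A
    · rw [h n hn, inner_zero_right]
    · rw [hg n hn, inner_zero_left]

theorem orthogonalProjectionOnto_functionsOn {A : Set Lattice} (f : LatticeSpace) {n : Lattice}
    (hn : n ∈ A) : ((functionsOn A).orthogonalProjectionOnto f : LatticeSpace) n = f n := by
  have h := mem_orthogonal_functionsOn.1
    ((functionsOn A).sub_starProjection_mem_orthogonal f) n hn
  exact (sub_eq_zero.1 h).symm

/-- Among `m` and its six neighbours, only `m + stdVec j` has a `j`-th coordinate exceeding `m j`.
-/
theorem laplacian_single_of_lt {m a : Lattice} {j : Fin 3} (h : m j < a j) :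
    laplacian (lp.single 2 m 1) a = (lp.single 2 (m + stdVec j) 1 : LatticeSpace) a := by
  have h0 : a ≠ m := fun e => h.ne (congrFun e j).symm
  have h1 : ∀ i, a + stdVec i ≠ m := fun i e => by
    have h3 := congrFun e j
    have h4 : 0 ≤ stdVec i j := by
      simp only [stdVec, Pi.single_apply]; split_ifs <;> simp
    rw [Pi.add_apply] at h3
    omega
  rw [laplacian_apply, Finset.sum_eq_single j]
  · rw [lp.single_apply_ne 2 m _ (h1 j), lp.single_apply_ne 2 m _ h0]
    simp only [lp.single_apply, Pi.single_apply, sub_eq_iff_eq_add]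
    ring
  · intro i _ hij
    have h2 : a - stdVec i ≠ m := fun e => by
      have h3 := congrFun e j
      rw [Pi.sub_apply, stdVec, Pi.single_eq_of_ne hij.symm] at h3
      omega
    rw [lp.single_apply_ne 2 m _ (h1 i), lp.single_apply_ne 2 m _ h0, lp.single_apply_ne 2 m _ h2]
    ring
  · simp

theorem laplacian_single_of_gt {m a : Lattice} {j : Fin 3} (h : a j < m j) :
    laplacian (lp.single 2 m 1) a = (lp.single 2 (m - stdVec j) 1 : LatticeSpace) a := by
  have h0 : a ≠ m := fun e => h.ne (congrFun e j)
  have h1 : ∀ i, a - stdVec i ≠ m := fun i e => by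
    have h3 := congrFun e j
    have h4 : 0 ≤ stdVec i j := by
      simp only [stdVec, Pi.single_apply]; split_ifs <;> simp
    rw [Pi.sub_apply] at h3
    omega
  rw [laplacian_apply, Finset.sum_eq_single j]
  · rw [lp.single_apply_ne 2 m _ (h1 j), lp.single_apply_ne 2 m _ h0]
    simp only [lp.single_apply, Pi.single_apply, eq_sub_iff_add_eq]
    ring
  · intro i _ hij
    have h2 : a + stdVec i ≠ m := fun e => by
      have h3 := congrFun e j
      rw [Pi.add_apply, stdVec, Pi.single_eq_of_ne hij.symm] at h3
      omega
    rw [lp.single_apply_ne 2 m _ (h1 i), lp.single_apply_ne 2 m _ h0, lp.single_apply_ne 2 m _ h2]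
    ring
  · simp

/-- The lattice points with all coordinates in `[a, b)`. -/
abbrev coordinateBox (a b : ℤ) : Finset Lattice := Fintype.piFinset fun _ => Finset.Ico a b

theorem coe_coordinateBox (N : ℕ) : (coordinateBox 0 N : Set Lattice) = cube N := by
  ext n
  simp [cube]

theorem cube_finite (N : ℕ) : (cube N).Finite := coe_coordinateBox N ▸ Finset.finite_toSet _

theorem cubeSurface_subset (N : ℕ) : cubeSurface N ⊆ cube N := fun _ h => h.1

theorem cubeSurface_finite (N : ℕ) : (cubeSurface N).Finite :=
  (cube_finite N).subset (cubeSurface_subset N)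

theorem ncard_cube (N : ℕ) : (cube N).ncard = N ^ 3 := by
  rw [← coe_coordinateBox, Set.ncard_coe_finset]
  simp

theorem ncard_cubeSurface {N : ℕ} (hN : 2 ≤ N) :
    ((cubeSurface N).ncard : ℤ) = 6 * (N : ℤ) ^ 2 - 12 * (N : ℤ) + 8 := by
  have h1 : cubeSurface N = ((coordinateBox 0 N \ coordinateBox 1 (N - 1) : Finset Lattice) :
      Set Lattice) := by
    ext n
    rw [Finset.coe_sdiff, coe_coordinateBox]
    simp only [cubeSurface, Set.mem_ofPred_eq, Set.mem_sdiff, Finset.mem_coe, Fintype.mem_piFinset,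
      Finset.mem_Ico, not_forall]
    refine and_congr_right fun h => exists_congr fun j => ?_
    have := h j
    omega
  have h2 : coordinateBox 1 (N - 1) ⊆ coordinateBox 0 N :=
    Fintype.piFinset_subset _ _ fun _ => Finset.Ico_subset_Ico (by simp) (by simp)
  -- The count is N³ - (N - 2)³. It needs `2 ≤ N`: for N = 1 the inner box is empty but (N - 2)³ =
  -- -1.
  obtain ⟨k, rfl⟩ := Nat.exists_eq_add_of_le hN
  have h3 : ((coordinateBox 1 ((2 + k : ℕ) - 1)).card : ℤ) = (k : ℤ) ^ 3 := by
    rw [Fintype.card_piFinset_const, Int.card_Ico]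
    have : (((2 + k : ℕ) : ℤ) - 1 - 1).toNat = k := by omega
    rw [this]
    simp
  have h4 : ((coordinateBox 0 ((2 + k : ℕ))).card : ℤ) = (2 + k : ℤ) ^ 3 := by
    rw [Fintype.card_piFinset_const, Int.card_Ico, sub_zero, Int.toNat_natCast]
    push_cast
    rfl
  rw [h1, Set.ncard_coe_finset, Finset.cast_card_sdiff h2, h3, h4]
  push_cast
  ring

theorem two_mul_ncard_cubeSurface_le {N : ℕ} (hN : 1 ≤ N) :
    ((2 * (cubeSurface N).ncard : ℕ) : ℤ) ≤ 12 * (N : ℤ) ^ 2 - 24 * (N : ℤ) + 16 := by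
  -- For N = 1 the surface has at most one point, and the bound is 4.
  rcases hN.eq_or_lt with rfl | hN
  · have h := Set.ncard_le_ncard (cubeSurface_subset 1) (cube_finite 1)
    rw [ncard_cube] at h
    push_cast
    norm_num at h ⊢
    omega
  · have h := ncard_cubeSurface hN
    push_cast
    linarith

theorem laplacian_single_mem {N : ℕ} {m : Lattice} (hm : m ∈ cube N) (hs : m ∉ cubeSurface N) :
    laplacian (lp.single 2 m 1) ∈ cubeSpace N := by
  have hin : ∀ j, 0 < m j ∧ m j < N - 1 := fun j => by
    have h1 := hm j
    have h2 : ¬ (m j = 0 ∨ m j = N - 1) := fun h => hs ⟨hm, j, h⟩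
    omega
  intro a ha
  simp only [cube, Set.mem_ofPred_eq, not_forall] at ha
  obtain ⟨j, hj⟩ := ha
  have h1 := hin j
  rcases lt_or_ge (a j) 0 with h | h
  · rw [laplacian_single_of_gt (j := j) (by omega)]
    refine lp.single_apply_ne 2 _ _ fun e => ?_
    have h3 := congrFun e j
    rw [Pi.sub_apply, stdVec, Pi.single_eq_same] at h3
    omega
  · rw [laplacian_single_of_lt (j := j) (by omega)]
    refine lp.single_apply_ne 2 _ _ fun e => ?_
    have h3 := congrFun e j
    rw [Pi.add_apply, stdVec, Pi.single_eq_same] at h3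
    omega

/-- The coupling operator maps the point mass at an outer neighbour of a surface point to the
point mass at the surface point. -/
theorem coupling_single {N : ℕ} {s m : Lattice} (hs : s ∈ cube N) (hm : m ∉ cube N)
    (h : ∀ a ∈ cube N, laplacian (lp.single 2 m 1) a = (lp.single 2 s 1 : LatticeSpace) a) :
    (lp.single 2 s 1 : LatticeSpace)
      ∈ (coupling laplacian (cubeSpace N)).range.map (cubeSpace N).subtype := by
  have hg : (lp.single 2 m 1 : LatticeSpace) ∈ (cubeSpace N)ᗮ :=
    mem_orthogonal_functionsOn.2 fun a ha => lp.single_apply_ne 2 m _ fun e => hm (e ▸ ha)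
  refine ⟨_, ⟨⟨_, hg⟩, rfl⟩, ?_⟩
  ext a
  by_cases ha : a ∈ cube N
  · exact (orthogonalProjectionOnto_functionsOn _ ha).trans (h a ha)
  · exact (((cubeSpace N).orthogonalProjectionOnto _).2 a ha).trans
      (single_mem_functionsOn hs a ha).symm

/-- By symmetry of Ω, the value of Γg at `n` is ⟨Ωδ_n, g⟩, which vanishes when Ωδ_n stays in the
cube, that is, off the surface. Conversely, the outer neighbour of a surface point `s` across a face
has `s` as its only neighbour in the cube. -/
theorem map_range_coupling (N : ℕ) :
    (coupling laplacian (cubeSpace N)).range.map (cubeSpace N).subtype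
      = functionsOn (cubeSurface N) := by
  refine le_antisymm ?_ (functionsOn_le (cubeSurface_finite N) ?_)
  · rintro _ ⟨_, ⟨g, rfl⟩, rfl⟩ n hn
    by_cases hc : n ∈ cube N
    · refine (orthogonalProjectionOnto_functionsOn _ hc).trans ?_
      have h1 := (ContinuousLinearMap.isSelfAdjoint_iff_isSymmetric.1 isSelfAdjoint_laplacian)
        (lp.single 2 n 1) g
      rw [← inner_single_one]
      exact h1.symm.trans ((Submodule.mem_orthogonal _ _).1 g.2 _ (laplacian_single_mem hc hn))
    · exact ((cubeSpace N).orthogonalProjectionOnto _).2 n hc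
  · rintro s ⟨hs, j, hj | hj⟩
    · have hm : (s - stdVec j) j = -1 := by
        rw [Pi.sub_apply, hj, stdVec, Pi.single_eq_same]; rfl
      refine coupling_single hs (m := s - stdVec j) (fun h => ?_) fun a ha => ?_
      · have := h j
        omega
      · have := ha j
        rw [laplacian_single_of_lt (j := j) (by omega), sub_add_cancel]
    · have hm : (s + stdVec j) j = N := by
        rw [Pi.add_apply, hj, stdVec, Pi.single_eq_same]; ring
      refine coupling_single hs (m := s + stdVec j) (fun h => ?_) fun a ha => ?_
      · have := h j
        omega
      · have := ha j
        rw [laplacian_single_of_gt (j := j) (by omega), add_sub_cancel_right]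

/-- The part of `Ωδ_s` off the cube. -/
def outerPart (N : ℕ) (s : Lattice) : LatticeSpace :=
  laplacian (lp.single 2 s 1)
    - (cubeSpace N).orthogonalProjectionOnto (laplacian (lp.single 2 s 1))

/-- The point masses on the surface and the outer parts of their images under the Laplacian. -/
def surfaceGenerators (N : ℕ) : Set LatticeSpace :=
  (fun s => lp.single 2 s 1) '' cubeSurface N ∪ outerPart N '' cubeSurface N

theorem encard_surfaceGenerators_le (N : ℕ) :
    (surfaceGenerators N).encard ≤ ((2 * (cubeSurface N).ncard : ℕ) : ℕ∞) := by
  refine (Set.encard_union_le _ _).trans ?_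
  rw [two_mul, Nat.cast_add, (cubeSurface_finite N).cast_ncard_eq]
  exact add_le_add (Set.encard_image_le _ _) (Set.encard_image_le _ _)

theorem surfaceGenerators_subset (N : ℕ) :
    surfaceGenerators N ⊆ minimalExtension laplacian (cubeSpace N) := by
  have hle := le_minimalExtension isSelfAdjoint_laplacian (cubeSpace N)
  have h1 : ∀ s ∈ cubeSurface N, (lp.single 2 s 1 : LatticeSpace)
      ∈ minimalExtension laplacian (cubeSpace N) := fun s hs =>
    hle (single_mem_functionsOn (cubeSurface_subset N hs))
  rintro _ (⟨s, hs, rfl⟩ | ⟨s, hs, rfl⟩)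
  · exact h1 s hs
  · exact Submodule.sub_mem _ (apply_mem_orbit isSelfAdjoint_laplacian (h1 s hs))
      (hle (Submodule.coe_mem _))

/-- Subtracting the outer part brings Ωδ_m back into the cube. Off the surface there is nothing to
subtract, so surface generators are enough. -/
theorem outerPart_mem (N : ℕ) {m : Lattice} (hm : m ∈ cube N) :
    outerPart N m ∈ orbit laplacian (surfaceGenerators N) := by
  by_cases hs : m ∈ cubeSurface N
  · exact subset_orbit isSelfAdjoint_laplacian _ (Or.inr ⟨m, hs, rfl⟩)
  · have h : outerPart N m = 0 := by
      rw [outerPart, ← Submodule.starProjection_apply,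
        Submodule.starProjection_eq_self_iff.2 (laplacian_single_mem hm hs), sub_self]
    rw [h]
    exact Submodule.zero_mem _

/-- Starting from the face on which the first coordinate vanishes, the generators yield the point
masses on the cube layer by layer. -/
theorem single_mem_orbit (N k : ℕ) : ∀ n ∈ cube N, n 0 ≤ k →
    (lp.single 2 n 1 : LatticeSpace) ∈ orbit laplacian (surfaceGenerators N) := by
  induction k with
  | zero =>
    intro n hn h
    have h0 : n 0 = 0 := le_antisymm (by simpa using h) (hn 0).1
    exact subset_orbit isSelfAdjoint_laplacian _ (Or.inl ⟨n, ⟨hn, 0, Or.inl h0⟩, rfl⟩)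
  | succ k ih =>
    intro n hn h
    rcases h.lt_or_eq with h | h
    · exact ih n hn (by push_cast at h; omega)
    let m : Lattice := n - stdVec 0
    have hm0 : m 0 = k := by
      simp only [m, Pi.sub_apply, h, stdVec, Pi.single_eq_same]
      push_cast
      ring
    have hm : m ∈ cube N := fun j => by
      have h1 := hn j
      by_cases hj : j = 0
      · subst hj; push_cast at h; omega
      · simpa [m, stdVec, Pi.single_eq_of_ne hj] using h1
    let p : LatticeSpace :=
      (cubeSpace N).orthogonalProjectionOnto (laplacian (lp.single 2 m 1))
    have hp : p ∈ orbit laplacian (surfaceGenerators N) := by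
      have h1 := Submodule.sub_mem _
        (apply_mem_orbit isSelfAdjoint_laplacian (ih m hm hm0.le)) (outerPart_mem N hm)
      rwa [outerPart, sub_sub_cancel] at h1
    -- Beyond layer `k` the projection `p` of Ωδ_m agrees with δ_n, so `p - δ_n` is supported on
    -- layers already obtained.
    let A : Set Lattice := {a ∈ cube N | a 0 ≤ k}
    have hr : p - lp.single 2 n 1 ∈ functionsOn A := fun a ha => by
      rw [lp.coeFn_sub, Pi.sub_apply, sub_eq_zero]
      by_cases hac : a ∈ cube N
      · have h1 : m 0 < a 0 := by
          have : ¬ a 0 ≤ k := fun h2 => ha ⟨hac, h2⟩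
          omega
        refine (orthogonalProjectionOnto_functionsOn _ hac).trans ?_
        rw [laplacian_single_of_lt h1, sub_add_cancel]
      · exact (((cubeSpace N).orthogonalProjectionOnto _).2 a hac).trans
          (single_mem_functionsOn hn a hac).symm
    have hr' := functionsOn_le ((cube_finite N).subset fun a ha => ha.1)
      (fun a ha => ih a ha.1 ha.2) hr
    simpa using Submodule.sub_mem _ hp hr'

theorem minimalExtension_le_orbit (N : ℕ) :
    minimalExtension laplacian (cubeSpace N) ≤ orbit laplacian (surfaceGenerators N) := by
  refine orbit_le isSelfAdjoint_laplacian (isClosed_orbit _ _)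
    (fun x hx => apply_mem_orbit isSelfAdjoint_laplacian hx) ?_
  exact functionsOn_le (cube_finite N) fun n hn => single_mem_orbit N N n hn (hn 0).2.le

end Cube
end LatticeExample

end

theorem mainTheorem2 (N : ℕ) (hN : 1 ≤ N) :
    Module.finrank ℂ (cubeSpace N) = N ^ 3 ∧
    (coupling laplacian (cubeSpace N)).range.map (cubeSpace N).subtype
      = functionsOn (cubeSurface N) ∧
    (2 ≤ N → (Module.finrank ℂ (coupling laplacian (cubeSpace N)).range : ℤ)
      = 6 * (N : ℤ) ^ 2 - 12 * (N : ℤ) + 8) ∧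
    (∃ h : ∀ f ∈ minimalExtension laplacian (cubeSpace N),
        laplacian f ∈ minimalExtension laplacian (cubeSpace N),
      ∃ m : ℕ, spectralMultiplicity (laplacian.restrict h) = m ∧
        (m : ℤ) ≤ 12 * (N : ℤ) ^ 2 - 24 * (N : ℤ) + 16) ∧
    spectralMultiplicity laplacian = ⊤ ∧
    (∃ h : ∀ f ∈ hiddenDecoupled laplacian (cubeSpace N),
        laplacian f ∈ hiddenDecoupled laplacian (cubeSpace N),
      spectralMultiplicity (laplacian.restrict h) = ⊤) := by
  have hsa := isSelfAdjoint_laplacian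
  have h : ∀ f ∈ minimalExtension laplacian (cubeSpace N),
      laplacian f ∈ minimalExtension laplacian (cubeSpace N) := fun f hf => apply_mem_orbit hsa hf
  have h' : ∀ f ∈ hiddenDecoupled laplacian (cubeSpace N),
      laplacian f ∈ hiddenDecoupled laplacian (cubeSpace N) := fun f hf =>
    apply_mem_hiddenDecoupled hsa _ hf
  have hle := (spectralMultiplicity_restrict_le hsa h (surfaceGenerators_subset N)
    (minimalExtension_le_orbit N)).trans (encard_surfaceGenerators_le N)
  obtain ⟨m, hm⟩ := ENat.ne_top_iff_exists.1 (ne_top_of_le_ne_top (ENat.natCast_ne_top _) hle)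
  refine ⟨(finrank_functionsOn (cube_finite N)).trans (ncard_cube N), map_range_coupling N,
    fun h2 => ?_, ⟨h, m, hm.symm, ?_⟩, spectralMultiplicity_laplacian, h', ?_⟩
  · rw [← ncard_cubeSurface h2, ← finrank_functionsOn (cubeSurface_finite N),
      ← map_range_coupling, Submodule.finrank_map_subtype_eq]
  · rw [← hm] at hle
    exact (Nat.cast_le.2 (Nat.cast_le.1 hle)).trans (two_mul_ncard_cubeSurface_le hN)
  -- The minimal extension has finite multiplicity, so the infinite multiplicity of Ω must come from
  -- the decoupled part.
  · by_contra hd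
    exact spectralMultiplicity_ne_top hsa h h' (hm ▸ ENat.natCast_ne_top m) hd
      spectralMultiplicity_laplacian
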